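/- Let $r=|x|$ for $x=(x_1,x_2)\in\mathbb{R}^2$, and let $\alpha\in\mathbb{R}$. Consider the two-dimensional stationary incompressible Euler equations $$u\cdot\nabla u+\nabla p=0,\qquad \nabla\cdot u=0 \tag{E}$$ for $u=(u^1,u^2)$ and $p$ (equivalently, the three-dimensional equations for the velocity $(u^1,u^2,0)$ and the pressure $p$, both independent of $x_3$). Let $\Omega=\mathbb{R}^2\setminus\{0\}$ or $\Omega=\mathbb{R}^2$. A *reflection-symmetric $(-\alpha)$-homogeneous solution on $\Omega$* is a pair of continuous functions $u:\Omega\to\mathbb{R}^2$, $p:\Omega\to\mathbb{R}$ such that * (E) holds in $\Omega$ in the sense of distributions, that is, $\int_\Omega \big(\sum_{i,j}u^iu^j\,\partial_j\varphi^i+p\,\nabla\cdot\varphi\big)\,dx=0$ and $\int_\Omega u\cdot\nabla\eta\,dx=0$ for all $\varphi\in C_c^\infty(\Omega;\mathbb{R}^2)$ and $\eta\in C_c^\infty(\Omega)$; * $u(x)=\lambda^{\alpha}u(\lambda x)$ and $p(x)=\lambda^{2\alpha}p(\lambda x)$ for all $\lambda>0$ and $x\in\Omega$; * $u^1(x_1,x_2)=u^1(x_1,-x_2)$,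 $u^2(x_1,x_2)=-u^2(x_1,-x_2)$ and $p(x_1,x_2)=p(x_1,-x_2)$ on $\Omega$; * $r^{2\alpha}p$ is constant on $\mathbb{R}^2\setminus\{0\}$. If $u\in C^1(\mathbb{R}^2\setminus\{0\})$, the solution is called *rotational* if $\omega=\partial_1u^2-\partial_2u^1$ does not vanish identically on $\mathbb{R}^2\setminus\{0\}$. **Theorem 1.7.** (i) For $0\le\alpha\le1$, there is no rotational reflection-symmetric $(-\alpha)$-homogeneous solution on $\mathbb{R}^2\setminus\{0\}$ with $u\in C^1(\mathbb{R}^2\setminus\{0\})$. (ii) For $-1\le\alpha<0$, there is no rotational reflection-symmetric $(-\alpha)$-homogeneous solution on $\mathbb{R}^2\setminus\{0\}$ with $u\in C^2(\mathbb{R}^2\setminus\{0\})$. (In particular there is none on $\mathbb{R}^2$.) (iii) For every $\alpha>1$, there is a rotational reflection-symmetric $(-\alpha)$-homogeneous solution on $\mathbb{R}^2\setminus\{0\}$ with $u\in C^2(\mathbb{R}^2\setminus\{0\})$. (iv) For every $\alpha<-1$, there is a rotational reflection-symmetric $(-\alpha)$-homogeneous solution on $\mathbb{R}^2$ with $u\in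 C^1(\mathbb{R}^2\setminus\{0\})\cap C(\mathbb{R}^2)$. -/

import Mathlib

open MeasureTheory

noncomputable section

/-- The Euclidean plane. -/
abbrev Plane : Type := EuclideanSpace ℝ (Fin 2)

/-- Reflection `(x₁, x₂) ↦ (x₁, -x₂)`. -/
def reflectPlane (x : Plane) : Plane := !₂[x 0, -x 1]

/-- The partial derivative `∂ᵢ g` at `x`. -/
def partialDeriv (i : Fin 2) (g : Plane → ℝ) (x : Plane) : ℝ :=
  fderiv ℝ g x (EuclideanSpace.single i 1)

/-- The divergence `∂₁φ¹ + ∂₂φ²`. -/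
def planeDiv (φ : Plane → Plane) (x : Plane) : ℝ :=
  ∑ i, partialDeriv i (fun y => φ y i) x

/-- The vorticity `ω = ∂₁u² - ∂₂u¹`, the only component of the curl of `(u¹, u², 0)`
that can be nonzero. -/
def vorticity (u : Plane → Plane) (x : Plane) : ℝ :=
  partialDeriv 0 (fun y => u y 1) x - partialDeriv 1 (fun y => u y 0) x

/-- `u` is rotational: its vorticity does not vanish identically away from the origin. -/
def IsRotational (u : Plane → Plane) : Prop :=
  ∃ x : Plane, x ≠ 0 ∧ vorticity u x ≠ 0

/-- `(u, p)`, continuous on `Ω`, solves the stationary incompressible Euler equations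
`u · ∇u + ∇p = 0`, `∇ · u = 0` on `Ω` in the sense of distributions. -/
structure IsEulerSolution (Ω : Set Plane) (u : Plane → Plane) (p : Plane → ℝ) : Prop where
  continuousOn_velocity : ContinuousOn u Ω
  continuousOn_pressure : ContinuousOn p Ω
  momentum : ∀ φ : Plane → Plane, ContDiff ℝ (⊤ : ℕ∞) φ → HasCompactSupport φ →
    tsupport φ ⊆ Ω →
    ∫ x, ((∑ i, ∑ j, u x i * u x j * partialDeriv j (fun y => φ y i) x)
      + p x * planeDiv φ x) = 0
  incompressible : ∀ η : Plane → ℝ, ContDiff ℝ (⊤ : ℕ∞) η → HasCompactSupport η →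
    tsupport η ⊆ Ω →
    ∫ x, (∑ i, u x i * partialDeriv i η x) = 0

/-- `(u, p)` is a 2D reflection symmetric `(-α)`-homogeneous solution of the Euler equations
on `Ω` such that `r ^ (2α) p` is constant (`r = |x|`). Used for `Ω = ℝ² ∖ {0}` and `Ω = ℝ²`. -/
structure IsReflSymmHomogeneousEulerSolution (Ω : Set Plane) (α : ℝ)
    (u : Plane → Plane) (p : Plane → ℝ) : Prop where
  euler : IsEulerSolution Ω u p
  velocity_homogeneous : ∀ l : ℝ, 0 < l → ∀ x ∈ Ω, u x = l ^ α • u (l • x)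
  pressure_homogeneous : ∀ l : ℝ, 0 < l → ∀ x ∈ Ω, p x = l ^ (2 * α) * p (l • x)
  velocity_symm_fst : ∀ x ∈ Ω, u x 0 = u (reflectPlane x) 0
  velocity_symm_snd : ∀ x ∈ Ω, u x 1 = -u (reflectPlane x) 1
  pressure_symm : ∀ x ∈ Ω, p x = p (reflectPlane x)
  pressure_const : ∃ c : ℝ, ∀ x : Plane, x ≠ 0 → ‖x‖ ^ (2 * α) * p x = c

end

/-! Write a homogeneous flow in polar form, `u = r^(-α) (f e_r + g e_θ)` with `p = c r^(-2α)`. The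
Euler equations become `g' = (α-1) f` and `g f' = α f² + g² + 2αc`, and the vorticity is `r^(-α-1)
W` with `W = (1-α) g - f'` (`euler_polar`). Two identities follow: `g W = -α (f² + g² + 2c)` and `(g
W)' = 2α f W`. Formally `g W' = (1+α) f W`, so for `α ≠ 1` the quantity `W |g|^γ` with `γ =
(1+α)/(1-α)` is constant on intervals where `g ≠ 0`.

Nonexistence. Reflection symmetry makes `g` odd, so `g 0 = 0`. For `-1 < α < 1` the exponent `γ` is
positive, the invariant extends by zero across the zeros of `g`, and it must vanish everywhere.
Hence `g W = 0`; on an open set where `W ≠ 0` one would have `g = 0`, then `f = 0`, then `W = 0`.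
For `α = 1`, `g` vanishes and `f²` is constant. For `α = -1`, `γ = 0` and the invariant is `W`
itself; `C²` regularity allows it to be differentiated, and evenness of `f` gives `W 0 = 0`.

Existence for `α > 1`. The exponent is now negative, so `W` may be a multiple of `|g|^(2/(α-1)) g`.
The pair `(g, f)` then runs around the closed curve `f² + g² + a² |g|^(2b) = 1 + a²`, `b = α/(α-1)`.
The amplitude `a` is tuned so that the period divides `2π` (`exists_half_period`), and the profiles
are extended homogeneously to the plane. For `α < -1` the shear flow `(|x₂|^(-α), 0)` with zero
pressure suffices. -/

open MeasureTheory

noncomputable section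

/-! ### Distributional versus pointwise Euler equations -/

theorem integrable_mul_of_tsupport_subset {Ω : Set Plane} (hΩ : IsOpen Ω) {w η : Plane → ℝ}
    (hw : ContinuousOn w Ω) (hη : ContinuousOn η Ω) (hc : HasCompactSupport η)
    (hs : tsupport η ⊆ Ω) : Integrable (fun x => w x * η x) :=
  ((hw.mul hη).continuous_of_tsupport_subset hΩ
    ((tsupport_mul_subset_right).trans hs)).integrable_of_hasCompactSupport hc.mul_left

theorem continuousOn_partialDeriv {Ω : Set Plane} (hΩ : IsOpen Ω) {w : Plane → ℝ}
    (hw : ContDiffOn ℝ 1 w Ω) (i : Fin 2) : ContinuousOn (partialDeriv i w) Ω :=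
  (hw.continuousOn_fderiv_of_isOpen hΩ le_rfl).clm_apply continuousOn_const

theorem tsupport_partialDeriv_subset (i : Fin 2) (η : Plane → ℝ) :
    tsupport (partialDeriv i η) ⊆ tsupport η :=
  tsupport_fderiv_apply_subset ℝ _

theorem differentiableAt_of_contDiffOn {Ω : Set Plane} (hΩ : IsOpen Ω) {w : Plane → ℝ}
    (hw : ContDiffOn ℝ 1 w Ω) {x : Plane} (hx : x ∈ Ω) : DifferentiableAt ℝ w x :=
  (hw.contDiffAt (hΩ.mem_nhds hx)).differentiableAt one_ne_zero

theorem integrable_mul_partialDeriv {Ω : Set Plane} (hΩ : IsOpen Ω) {w η : Plane → ℝ}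
    (hw : ContinuousOn w Ω) (hη : ContDiff ℝ (⊤ : ℕ∞) η) (hc : HasCompactSupport η)
    (hs : tsupport η ⊆ Ω) (i : Fin 2) : Integrable (fun x => w x * partialDeriv i η x) :=
  integrable_mul_of_tsupport_subset hΩ hw
    (continuousOn_partialDeriv hΩ (hη.contDiffOn.of_le (by exact_mod_cast le_top)) i)
    (hc.mono' ((subset_tsupport _).trans (tsupport_partialDeriv_subset i η)))
    ((tsupport_partialDeriv_subset i η).trans hs)

theorem integral_mul_partialDeriv {Ω : Set Plane} (hΩ : IsOpen Ω) {w η : Plane → ℝ}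
    (hw : ContDiffOn ℝ 1 w Ω) (hη : ContDiff ℝ (⊤ : ℕ∞) η) (hc : HasCompactSupport η)
    (hs : tsupport η ⊆ Ω) (i : Fin 2) :
    ∫ x, w x * partialDeriv i η x = ∫ x, η x * (-partialDeriv i w x) := by
  have := integral_mul_fderiv_eq_neg_fderiv_mul_of_integrable (μ := (volume : Measure Plane))
    (f := w) (g := η) (v := EuclideanSpace.single i 1)
    (integrable_mul_of_tsupport_subset hΩ (continuousOn_partialDeriv hΩ hw i)
      hη.continuous.continuousOn hc hs)
    (integrable_mul_partialDeriv hΩ hw.continuousOn hη hc hs i)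
    (integrable_mul_of_tsupport_subset hΩ hw.continuousOn hη.continuous.continuousOn hc hs)
    (fun x hx => differentiableAt_of_contDiffOn hΩ hw (hs hx))
    (fun x _ => (hη.differentiable (by simp)).differentiableAt)
  simp only [partialDeriv, mul_neg, integral_neg]
  rw [this]
  simp only [mul_comm]

theorem integrable_mul_neg_partialDeriv {Ω : Set Plane} (hΩ : IsOpen Ω) {w η : Plane → ℝ}
    (hw : ContDiffOn ℝ 1 w Ω) (hη : ContDiff ℝ (⊤ : ℕ∞) η) (hc : HasCompactSupport η)
    (hs : tsupport η ⊆ Ω) (i : Fin 2) :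
    Integrable (fun x => η x * (-partialDeriv i w x)) := by
  simpa only [mul_comm, Pi.neg_apply] using integrable_mul_of_tsupport_subset hΩ
    (continuousOn_partialDeriv hΩ hw i).neg hη.continuous.continuousOn hc hs

theorem eq_zero_of_integral_test_mul_eq_zero {Ω : Set Plane} (hΩ : IsOpen Ω) {w : Plane → ℝ}
    (hw : ContinuousOn w Ω)
    (h : ∀ η : Plane → ℝ, ContDiff ℝ (⊤ : ℕ∞) η → HasCompactSupport η → tsupport η ⊆ Ω →
      ∫ x, η x * w x = 0) : ∀ x ∈ Ω, w x = 0 := by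
  have hae := hΩ.ae_eq_zero_of_integral_contDiff_smul_eq_zero (μ := volume)
    (hw.locallyIntegrableOn hΩ.measurableSet) h
  rw [← ae_restrict_iff' hΩ.measurableSet] at hae
  exact Measure.eqOn_open_of_ae_eq hae hΩ hw continuousOn_const

/-- The divergence of the tensor `u ⊗ u` plus the pressure gradient, tested against `φ`. -/
theorem integral_momentum {Ω : Set Plane} (hΩ : IsOpen Ω) {u φ : Plane → Plane} {p : Plane → ℝ}
    (hu : ContDiffOn ℝ 1 u Ω) (hp : ContDiffOn ℝ 1 p Ω)
    (hφ : ContDiff ℝ (⊤ : ℕ∞) φ) (hc : HasCompactSupport φ) (hs : tsupport φ ⊆ Ω) :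
    ∫ x, ((∑ i, ∑ j, u x i * u x j * partialDeriv j (fun y => φ y i) x) + p x * planeDiv φ x)
      = ∫ x, ∑ i, φ x i * -((∑ j, partialDeriv j (fun y => u y i * u y j) x)
        + partialDeriv i p x) := by
  have hui : ∀ i, ContDiffOn ℝ 1 (fun x => u x i) Ω := fun i => (contDiffOn_euclidean.1 hu) i
  have hφi : ∀ i, ContDiff ℝ (⊤ : ℕ∞) (fun x => φ x i) := fun i => (contDiff_euclidean.1 hφ) i
  have hsi : ∀ i, tsupport (fun x => φ x i) ⊆ tsupport φ := fun i =>
    closure_mono fun x hx => by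
      simp only [Function.mem_support] at hx ⊢
      intro h0; apply hx; simp [h0]
  have hci : ∀ i, HasCompactSupport (fun x => φ x i) := fun i =>
    hc.mono' ((subset_tsupport _).trans (hsi i))
  have hss : ∀ i, tsupport (fun x => φ x i) ⊆ Ω := fun i => (hsi i).trans hs
  have huu : ∀ i j, ContDiffOn ℝ 1 (fun x => u x i * u x j) Ω := fun i j => (hui i).mul (hui j)
  have e1 : ∀ i j, ∫ x, u x i * u x j * partialDeriv j (fun y => φ y i) x = _ := fun i j =>
    integral_mul_partialDeriv hΩ (huu i j) (hφi i) (hci i) (hss i) j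
  have i1 : ∀ i j, Integrable (fun x => u x i * u x j * partialDeriv j (fun y => φ y i) x) :=
    fun i j => integrable_mul_partialDeriv hΩ (huu i j).continuousOn (hφi i) (hci i) (hss i) j
  have e2 : ∀ i, ∫ x, p x * partialDeriv i (fun y => φ y i) x = _ := fun i =>
    integral_mul_partialDeriv hΩ hp (hφi i) (hci i) (hss i) i
  have i2 : ∀ i, Integrable (fun x => p x * partialDeriv i (fun y => φ y i) x) :=
    fun i => integrable_mul_partialDeriv hΩ hp.continuousOn (hφi i) (hci i) (hss i) i
  have i3 := fun i j => integrable_mul_neg_partialDeriv hΩ (huu i j) (hφi i) (hci i) (hss i) j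
  have i4 := fun i => integrable_mul_neg_partialDeriv hΩ hp (hφi i) (hci i) (hss i) i
  simp only [planeDiv, Finset.mul_sum]
  rw [integral_add (integrable_finsetSum _ fun i _ => integrable_finsetSum _ fun j _ => i1 i j)
    (integrable_finsetSum _ fun i _ => i2 i), integral_finsetSum _ fun i _ => i2 i,
    integral_finsetSum _ fun i _ => integrable_finsetSum _ fun j _ => i1 i j]
  simp_rw [integral_finsetSum Finset.univ fun j _ => i1 _ j, e1, e2]
  rw [← Finset.sum_add_distrib]
  simp only [neg_add, mul_add, ← Finset.sum_neg_distrib, Finset.mul_sum]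
  have i5 : ∀ i, Integrable (fun x => (∑ j, φ x i * -partialDeriv j (fun y => u y i * u y j) x)
      + φ x i * -partialDeriv i p x) := fun i =>
    (integrable_finsetSum _ fun j _ => i3 i j).add (i4 i)
  rw [integral_finsetSum _ fun i _ => i5 i]
  refine Finset.sum_congr rfl fun i _ => ?_
  rw [integral_add (integrable_finsetSum _ fun j _ => i3 i j) (i4 i),
    integral_finsetSum _ fun j _ => i3 i j]

theorem integral_incompressible {Ω : Set Plane} (hΩ : IsOpen Ω) {u : Plane → Plane}
    {η : Plane → ℝ} (hu : ContDiffOn ℝ 1 u Ω)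
    (hη : ContDiff ℝ (⊤ : ℕ∞) η) (hc : HasCompactSupport η) (hs : tsupport η ⊆ Ω) :
    ∫ x, (∑ i, u x i * partialDeriv i η x) = ∫ x, η x * -planeDiv u x := by
  have hui : ∀ i, ContDiffOn ℝ 1 (fun x => u x i) Ω := fun i => (contDiffOn_euclidean.1 hu) i
  simp only [planeDiv, ← Finset.sum_neg_distrib, Finset.mul_sum]
  rw [integral_finsetSum _ fun i _ =>
      integrable_mul_partialDeriv hΩ (hui i).continuousOn hη hc hs i,
    integral_finsetSum _ fun i _ => integrable_mul_neg_partialDeriv hΩ (hui i) hη hc hs i]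
  exact Finset.sum_congr rfl fun i _ => integral_mul_partialDeriv hΩ (hui i) hη hc hs i

theorem sum_partialDeriv_mul {Ω : Set Plane} (hΩ : IsOpen Ω) {u : Plane → Plane}
    (hu : ContDiffOn ℝ 1 u Ω) {x : Plane} (hx : x ∈ Ω) (i : Fin 2) :
    ∑ j, partialDeriv j (fun y => u y i * u y j) x =
      u x i * planeDiv u x + ∑ j, u x j * partialDeriv j (fun y => u y i) x := by
  have hd : ∀ i, DifferentiableAt ℝ (fun x => u x i) x := fun i =>
    differentiableAt_of_contDiffOn hΩ ((contDiffOn_euclidean.1 hu) i) hx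
  simp only [planeDiv, Finset.mul_sum, ← Finset.sum_add_distrib, partialDeriv]
  refine Finset.sum_congr rfl fun j _ => ?_
  rw [fderiv_fun_mul (hd i) (hd j)]
  simp

/-- For `C¹` velocity and pressure the distributional Euler equations hold exactly when the
pointwise ones do. -/
theorem isEulerSolution_iff_pointwise {Ω : Set Plane} (hΩ : IsOpen Ω) {u : Plane → Plane}
    {p : Plane → ℝ} (hu : ContDiffOn ℝ 1 u Ω) (hp : ContDiffOn ℝ 1 p Ω) :
    IsEulerSolution Ω u p ↔ ∀ x ∈ Ω, planeDiv u x = 0 ∧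
      ∀ i, (∑ j, u x j * partialDeriv j (fun y => u y i) x) + partialDeriv i p x = 0 := by
  have hui : ∀ i, ContDiffOn ℝ 1 (fun x => u x i) Ω := fun i => (contDiffOn_euclidean.1 hu) i
  constructor
  · intro h
    have hdiv : ∀ x ∈ Ω, -planeDiv u x = 0 := by
      apply eq_zero_of_integral_test_mul_eq_zero hΩ
      · exact (continuousOn_finsetSum _ fun i _ => continuousOn_partialDeriv hΩ (hui i) i).neg
      · intro η h1 h2 h3
        rw [← integral_incompressible hΩ hu h1 h2 h3]
        exact h.incompressible η h1 h2 h3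
    have hmom : ∀ i, ∀ x ∈ Ω, -((∑ j, partialDeriv j (fun y => u y i * u y j) x)
        + partialDeriv i p x) = 0 := by
      intro i
      apply eq_zero_of_integral_test_mul_eq_zero hΩ
      · exact ((continuousOn_finsetSum _ fun j _ => continuousOn_partialDeriv hΩ
          ((hui i).mul (hui j)) j).add (continuousOn_partialDeriv hΩ hp i)).neg
      · intro η h1 h2 h3
        -- The test field `η e_i` isolates the `i`-th momentum equation.
        have hφ : ContDiff ℝ (⊤ : ℕ∞) (fun x => η x • (EuclideanSpace.single i 1 : Plane)) :=
          h1.smul contDiff_const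
        have hφc : HasCompactSupport (fun x => η x • (EuclideanSpace.single i 1 : Plane)) :=
          h2.smul_right
        have hφs : tsupport (fun x => η x • (EuclideanSpace.single i 1 : Plane)) ⊆ Ω :=
          (tsupport_smul_subset_left η _).trans h3
        have := h.momentum _ hφ hφc hφs
        rw [integral_momentum hΩ hu hp hφ hφc hφs] at this
        rw [← this]
        congr 1
        ext x
        refine ((Finset.sum_eq_single i (fun k _ hk => ?_) (by simp)).trans ?_).symm
        · simp [hk]
        · simp
    intro x hx
    have h1 : planeDiv u x = 0 := neg_eq_zero.1 (hdiv x hx)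
    refine ⟨h1, fun i => ?_⟩
    have h2 := neg_eq_zero.1 (hmom i x hx)
    rwa [sum_partialDeriv_mul hΩ hu hx, h1, mul_zero, zero_add] at h2
  · intro h
    refine ⟨hu.continuousOn, hp.continuousOn, fun φ h1 h2 h3 => ?_, fun η h1 h2 h3 => ?_⟩
    · rw [integral_momentum hΩ hu hp h1 h2 h3]
      refine integral_eq_zero_of_ae (Filter.Eventually.of_forall fun x => ?_)
      refine Finset.sum_eq_zero fun i _ => ?_
      by_cases hx : x ∈ Ω
      · rw [sum_partialDeriv_mul hΩ hu hx, (h x hx).1, mul_zero, zero_add, (h x hx).2 i]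
        simp
      · rw [image_eq_zero_of_notMem_tsupport fun hx' => hx (h3 hx')]
        simp
    · rw [integral_incompressible hΩ hu h1 h2 h3]
      refine integral_eq_zero_of_ae (Filter.Eventually.of_forall fun x => ?_)
      by_cases hx : x ∈ Ω
      · simp [(h x hx).1]
      · simp [image_eq_zero_of_notMem_tsupport fun hx' => hx (h3 hx')]

/-! ### Polar coordinates and reduction to angular profiles -/

/-- The unit vector at angle `θ`. -/
def unitVec (θ : ℝ) : Plane := !₂[Real.cos θ, Real.sin θ]

@[simp] theorem unitVec_zero (θ : ℝ) : unitVec θ 0 = Real.cos θ := rfl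
@[simp] theorem unitVec_one (θ : ℝ) : unitVec θ 1 = Real.sin θ := rfl

theorem norm_unitVec (θ : ℝ) : ‖unitVec θ‖ = 1 := by
  simp [EuclideanSpace.norm_eq]

theorem norm_smul_unitVec {r : ℝ} (hr : 0 < r) (θ : ℝ) : ‖r • unitVec θ‖ = r := by
  rw [norm_smul, norm_unitVec, mul_one, Real.norm_of_nonneg hr.le]

theorem smul_unitVec_ne_zero {r : ℝ} (hr : 0 < r) (θ : ℝ) : r • unitVec θ ≠ 0 := by
  rw [← norm_pos_iff, norm_smul_unitVec hr]; exact hr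

/-- The polar angle in `(-π, π]`. -/
def polarAngle (x : Plane) : ℝ := Complex.arg ⟨x 0, x 1⟩

theorem norm_smul_unitVec_polarAngle (x : Plane) : ‖x‖ • unitVec (polarAngle x) = x := by
  have h : ‖(⟨x 0, x 1⟩ : ℂ)‖ = ‖x‖ := by
    rw [Complex.norm_eq_sqrt_sq_add_sq, EuclideanSpace.norm_eq]
    simp
  ext i
  fin_cases i
  · simpa [polarAngle, h] using Complex.norm_mul_cos_arg ⟨x 0, x 1⟩
  · simpa [polarAngle, h] using Complex.norm_mul_sin_arg ⟨x 0, x 1⟩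

theorem hasDerivAt_unitVec (θ : ℝ) :
    HasDerivAt unitVec (!₂[-Real.sin θ, Real.cos θ] : Plane) θ := by
  have h := ((Real.hasDerivAt_cos θ).smul_const (EuclideanSpace.single 0 1 : Plane)).add
    ((Real.hasDerivAt_sin θ).smul_const (EuclideanSpace.single 1 1 : Plane))
  have h1 : unitVec = (fun t => Real.cos t • (EuclideanSpace.single 0 1 : Plane)) +
      fun t => Real.sin t • (EuclideanSpace.single 1 1 : Plane) := by
    ext t i; fin_cases i <;> simp
  have h2 : (!₂[-Real.sin θ, Real.cos θ] : Plane) = -Real.sin θ •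
      (EuclideanSpace.single 0 1 : Plane) + Real.cos θ • (EuclideanSpace.single 1 1 : Plane) := by
    ext i; fin_cases i <;> simp
  rw [h1, h2]
  exact h

theorem fderiv_apply_eq_partialDeriv (w : Plane → ℝ) (x v : Plane) :
    fderiv ℝ w x v = v 0 * partialDeriv 0 w x + v 1 * partialDeriv 1 w x := by
  have : v = v 0 • EuclideanSpace.single 0 1 + v 1 • EuclideanSpace.single 1 1 := by
    ext i; fin_cases i <;> simp
  conv_lhs => rw [this]
  simp [partialDeriv]

/-- Partial derivatives of a homogeneous function of degree `s` with angular profile `W`. -/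
theorem partialDeriv_of_homogeneous {w : Plane → ℝ} {W : ℝ → ℝ} {s : ℝ}
    (hw : ∀ r > 0, ∀ θ, w (r • unitVec θ) = r ^ s * W θ) {r : ℝ} (hr : 0 < r) {θ W' : ℝ}
    (hd : DifferentiableAt ℝ w (r • unitVec θ)) (hW : HasDerivAt W W' θ) :
    partialDeriv 0 w (r • unitVec θ) = r ^ (s - 1) * (s * Real.cos θ * W θ - Real.sin θ * W') ∧
    partialDeriv 1 w (r • unitVec θ) = r ^ (s - 1) * (s * Real.sin θ * W θ + Real.cos θ * W') := by
  have hrad : fderiv ℝ w (r • unitVec θ) (unitVec θ) = s * r ^ (s - 1) * W θ := by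
    have h1 : HasDerivAt (fun t : ℝ => t • unitVec θ) (unitVec θ) r := by
      simpa using (hasDerivAt_id r).smul_const (unitVec θ)
    have h2 := hd.hasFDerivAt.comp_hasDerivAt r h1
    have h3 : HasDerivAt (fun t : ℝ => t ^ s * W θ) (s * r ^ (s - 1) * W θ) r :=
      (Real.hasDerivAt_rpow_const (Or.inl hr.ne')).mul_const _
    refine h2.unique (h3.congr_of_eventuallyEq ?_)
    filter_upwards [lt_mem_nhds hr] with t ht using hw t ht θ
  have hang : fderiv ℝ w (r • unitVec θ) (r • (!₂[-Real.sin θ, Real.cos θ] : Plane)) =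
      r ^ s * W' := by
    have h2 := hd.hasFDerivAt.comp_hasDerivAt θ ((hasDerivAt_unitVec θ).const_smul r)
    refine h2.unique ((hW.const_mul (r ^ s)).congr_of_eventuallyEq ?_)
    exact Filter.Eventually.of_forall fun t => hw r hr t
  rw [fderiv_apply_eq_partialDeriv] at hrad hang
  have hrs : r ^ s = r ^ (s - 1) * r := by
    rw [Real.rpow_sub_one hr.ne', div_mul_cancel₀ _ hr.ne']
  have hang' : -Real.sin θ * partialDeriv 0 w (r • unitVec θ) +
      Real.cos θ * partialDeriv 1 w (r • unitVec θ) = r ^ (s - 1) * W' := by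
    apply mul_left_cancel₀ hr.ne'
    rw [hrs] at hang
    simp at hang
    linear_combination hang
  simp only [unitVec_zero, unitVec_one] at hrad
  have hcs := Real.sin_sq_add_cos_sq θ
  constructor
  · linear_combination Real.cos θ * hrad - Real.sin θ * hang' -
      partialDeriv 0 w (r • unitVec θ) * hcs
  · linear_combination Real.sin θ * hrad + Real.cos θ * hang' -
      partialDeriv 1 w (r • unitVec θ) * hcs

theorem contDiff_profile {w : Plane → ℝ} {W : ℝ → ℝ} {s : ℝ}
    (hw : ∀ r > 0, ∀ θ, w (r • unitVec θ) = r ^ s * W θ) {n : ℕ∞}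
    (hd : ContDiffOn ℝ n w {0}ᶜ) : ContDiff ℝ n W := by
  have h1 : W = w ∘ unitVec := by
    ext θ
    simpa using (hw 1 one_pos θ).symm
  have h2 : ContDiff ℝ n unitVec := by
    rw [contDiff_euclidean]
    intro i
    fin_cases i
    · exact Real.contDiff_cos
    · exact Real.contDiff_sin
  rw [h1, ← contDiffOn_univ]
  refine hd.comp h2.contDiffOn fun θ _ => ?_
  simpa using smul_unitVec_ne_zero one_pos θ

/-- The pointwise Euler equations and the vorticity in terms of the radial and angular profiles
`f`, `g` of a homogeneous velocity field. -/
theorem euler_polar {u : Plane → Plane} {p : Plane → ℝ} {α c : ℝ} {f g : ℝ → ℝ}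
    (hu0 : ∀ r > 0, ∀ θ, u (r • unitVec θ) 0 =
      r ^ (-α) * (f θ * Real.cos θ - g θ * Real.sin θ))
    (hu1 : ∀ r > 0, ∀ θ, u (r • unitVec θ) 1 =
      r ^ (-α) * (f θ * Real.sin θ + g θ * Real.cos θ))
    (hp : ∀ r > 0, ∀ θ, p (r • unitVec θ) = r ^ (-(2 * α)) * c)
    (hdu : ContDiffOn ℝ 1 u {0}ᶜ) (hdp : ContDiffOn ℝ 1 p {0}ᶜ)
    {r : ℝ} (hr : 0 < r) {θ f' g' : ℝ} (hf : HasDerivAt f f' θ) (hg : HasDerivAt g g' θ) :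
    ((planeDiv u (r • unitVec θ) = 0 ∧ ∀ i, (∑ j, u (r • unitVec θ) j *
        partialDeriv j (fun y => u y i) (r • unitVec θ)) + partialDeriv i p (r • unitVec θ) = 0) ↔
      (g' = (α - 1) * f θ ∧ g θ * f' = α * f θ ^ 2 + g θ ^ 2 + 2 * α * c)) ∧
    vorticity u (r • unitVec θ) = r ^ (-α - 1) * ((1 - α) * g θ - f') := by
  have hx : r • unitVec θ ∈ ({0}ᶜ : Set Plane) := smul_unitVec_ne_zero hr θ
  have hd : ∀ i, DifferentiableAt ℝ (fun x => u x i) (r • unitVec θ) := fun i =>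
    differentiableAt_of_contDiffOn isOpen_compl_singleton ((contDiffOn_euclidean.1 hdu) i) hx
  have hsin := Real.hasDerivAt_sin θ
  have hcos := Real.hasDerivAt_cos θ
  obtain ⟨a0, a1⟩ := partialDeriv_of_homogeneous hu0 hr (hd 0)
    ((hf.fun_mul hcos).fun_sub (hg.fun_mul hsin))
  obtain ⟨b0, b1⟩ := partialDeriv_of_homogeneous hu1 hr (hd 1)
    ((hf.fun_mul hsin).fun_add (hg.fun_mul hcos))
  obtain ⟨p0, p1⟩ := partialDeriv_of_homogeneous (W := fun _ => c) hp hr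
    (differentiableAt_of_contDiffOn isOpen_compl_singleton hdp hx) (hasDerivAt_const θ c)
  have hcs := Real.sin_sq_add_cos_sq θ
  have hpow : r ^ (-α) * r ^ (-α - 1) = r ^ (-(2 * α) - 1) := by
    rw [← Real.rpow_add hr]; ring_nf
  have hpos1 : r ^ (-α - 1) ≠ 0 := (Real.rpow_pos_of_pos hr _).ne'
  have hpos2 : r ^ (-(2 * α) - 1) ≠ 0 := (Real.rpow_pos_of_pos hr _).ne'
  set S := Real.sin θ
  set C := Real.cos θ
  have hdiv : planeDiv u (r • unitVec θ) = r ^ (-α - 1) * (g' - (α - 1) * f θ) := by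
    rw [planeDiv, Fin.sum_univ_two, a0, b1]
    linear_combination r ^ (-α - 1) * (g' - (α - 1) * f θ) * hcs
  -- `A` and `B` are the radial and tangential components of the momentum equation. Since the
  -- pressure does not depend on the angle, `B` is `g` times the divergence factor and adds no
  -- condition.
  set A := -α * f θ ^ 2 + g θ * f' - g θ ^ 2 - 2 * α * c with hA
  set B := g θ * (g' - (α - 1) * f θ) with hB
  have hm0 : (∑ j, u (r • unitVec θ) j * partialDeriv j (fun y => u y 0) (r • unitVec θ)) +
      partialDeriv 0 p (r • unitVec θ) = r ^ (-(2 * α) - 1) * (C * A - S * B) := by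
    rw [Fin.sum_univ_two, a0, a1, p0, hu0 r hr, hu1 r hr, ← hpow]
    linear_combination (r ^ (-α) * r ^ (-α - 1)) * (C * (A + 2 * α * c) - S * B) * hcs
  have hm1 : (∑ j, u (r • unitVec θ) j * partialDeriv j (fun y => u y 1) (r • unitVec θ)) +
      partialDeriv 1 p (r • unitVec θ) = r ^ (-(2 * α) - 1) * (S * A + C * B) := by
    rw [Fin.sum_univ_two, b0, b1, p1, hu0 r hr, hu1 r hr, ← hpow]
    linear_combination (r ^ (-α) * r ^ (-α - 1)) * (S * (A + 2 * α * c) + C * B) * hcs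
  refine ⟨?_, ?_⟩
  · rw [Fin.forall_fin_two, hdiv, hm0, hm1]
    simp only [mul_eq_zero, hpos1, hpos2, false_or]
    constructor
    · rintro ⟨h1, h2, h3⟩
      refine ⟨by linarith, ?_⟩
      have : A = 0 := by linear_combination C * h2 + S * h3 - A * hcs
      linarith
    · rintro ⟨h1, h2⟩
      have hA0 : A = 0 := by linarith
      have hB0 : B = 0 := by rw [hB, h1]; ring
      simp [hA0, hB0, h1]
  · rw [vorticity, a1, b0]
    linear_combination r ^ (-α - 1) * ((1 - α) * g θ - f') * hcs

/-! ### The profile system: when the angular vorticity must vanish -/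

open Filter Topology in
-- If `D θ ≠ 0`, continuity forces `g` to vanish near `θ`, which `hloc` excludes. Used with `D = W`
-- and with `D = W'`.
theorem eq_zero_of_mul_eq_zero_of_local {D g : ℝ → ℝ} (hD : Continuous D)
    (h : ∀ θ, D θ * g θ = 0) (hloc : ∀ θ, (∀ᶠ t in 𝓝 θ, g t = 0) → D θ = 0) (θ : ℝ) :
    D θ = 0 := by
  by_contra hne
  refine hne (hloc θ ?_)
  filter_upwards [hD.continuousAt.eventually_ne hne] with t ht
  exact (mul_eq_zero.1 (h t)).resolve_left ht

open Filter Topology in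
-- A level set at a nonzero value is closed by continuity and open by the derivative hypothesis, so
-- it would be the whole line and contain `a`. Nothing is asked about derivatives at zeros of `Ψ`,
-- where the invariant below may fail to be smooth.
theorem eq_zero_of_hasDerivAt_zero_of_ne {Ψ : ℝ → ℝ} (hc : Continuous Ψ) {a : ℝ} (ha : Ψ a = 0)
    (h : ∀ θ, Ψ θ ≠ 0 → HasDerivAt Ψ 0 θ) (θ : ℝ) : Ψ θ = 0 := by
  by_contra hne
  have hopen : IsOpen {t | Ψ t = Ψ θ} := by
    rw [isOpen_iff_mem_nhds]
    intro t (ht : Ψ t = Ψ θ)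
    have hev : ∀ᶠ s in 𝓝 t, Ψ s ≠ 0 := hc.continuousAt.eventually_ne (by rwa [ht])
    obtain ⟨ε, hε, hball⟩ := Metric.eventually_nhds_iff_ball.1 hev
    refine mem_of_superset (Metric.ball_mem_nhds t hε) fun s hs => ?_
    refine (Metric.isOpen_ball.is_const_of_deriv_eq_zero (convex_ball t ε).isPreconnected
      (fun y hy => (h y (hball y hy)).differentiableAt.differentiableWithinAt)
      (fun y hy => (h y (hball y hy)).deriv) hs (Metric.mem_ball_self hε)).trans ht
  have huniv : {t | Ψ t = Ψ θ} = Set.univ :=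
    IsClopen.eq_univ ⟨isClosed_eq hc continuous_const, hopen⟩ ⟨θ, rfl⟩
  have : a ∈ {t | Ψ t = Ψ θ} := huniv ▸ Set.mem_univ a
  exact hne (this.symm.trans ha)

/-- The ordinary differential system satisfied by the radial and angular profiles `f`, `g` of a
`(-α)`-homogeneous Euler flow with pressure `c r ^ (-2α)`. -/
structure ProfileSystem (α c : ℝ) (f g : ℝ → ℝ) : Prop where
  contDiff_fst : ContDiff ℝ 1 f
  contDiff_snd : ContDiff ℝ 1 g
  continuity : ∀ θ, deriv g θ = (α - 1) * f θ
  momentum : ∀ θ, g θ * deriv f θ = α * f θ ^ 2 + g θ ^ 2 + 2 * α * c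

namespace ProfileSystem

variable {α c : ℝ} {f g : ℝ → ℝ}

/-- The angular profile of the vorticity. -/
def angularVorticity (α : ℝ) (f g : ℝ → ℝ) (θ : ℝ) : ℝ := (1 - α) * g θ - deriv f θ

theorem hasDerivAt_fst (h : ProfileSystem α c f g) (θ : ℝ) : HasDerivAt f (deriv f θ) θ :=
  ((h.contDiff_fst.differentiable one_ne_zero) θ).hasDerivAt

theorem hasDerivAt_snd (h : ProfileSystem α c f g) (θ : ℝ) :
    HasDerivAt g ((α - 1) * f θ) θ := by
  rw [← h.continuity]
  exact ((h.contDiff_snd.differentiable one_ne_zero) θ).hasDerivAt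

theorem continuous_angularVorticity (h : ProfileSystem α c f g) :
    Continuous (angularVorticity α f g) :=
  (continuous_const.mul h.contDiff_snd.continuous).sub (h.contDiff_fst.continuous_deriv le_rfl)

theorem mul_angularVorticity (h : ProfileSystem α c f g) (θ : ℝ) :
    g θ * angularVorticity α f g θ = -α * (f θ ^ 2 + g θ ^ 2 + 2 * c) := by
  rw [angularVorticity]
  linear_combination -h.momentum θ

/-- `W` contains `f'` and is merely continuous, but `g W` is a polynomial in the `C¹` functions `f`
and `g`. This is why `C¹` regularity is enough for `-1 < α < 1`. -/
theorem hasDerivAt_mul_angularVorticity (h : ProfileSystem α c f g) (θ : ℝ) :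
    HasDerivAt (fun t => g t * angularVorticity α f g t)
      (2 * α * f θ * angularVorticity α f g θ) θ := by
  have h1 := ((((h.hasDerivAt_fst θ).pow 2).add ((h.hasDerivAt_snd θ).pow 2)).add_const
    (2 * c)).const_mul (-α)
  refine (h1.congr_of_eventuallyEq (Filter.Eventually.of_forall
    h.mul_angularVorticity)).congr_deriv ?_
  rw [angularVorticity]
  simp
  ring

open Filter Topology in
theorem angularVorticity_eq_zero_of_eventually (h : ProfileSystem α c f g) (hα : α ≠ 1) {θ : ℝ}
    (hg : ∀ᶠ t in 𝓝 θ, g t = 0) : ∀ᶠ t in 𝓝 θ, angularVorticity α f g t = 0 := by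
  have hf : ∀ᶠ t in 𝓝 θ, f t = 0 := by
    filter_upwards [hg.eventually_nhds] with t ht
    have h1 : deriv g t = 0 := by
      rw [(show g =ᶠ[𝓝 t] fun _ => 0 from ht).deriv_eq, deriv_const]
    rw [h.continuity, mul_eq_zero] at h1
    exact h1.resolve_left (sub_ne_zero.2 hα)
  filter_upwards [hf.eventually_nhds, hg] with t ht hgt
  rw [angularVorticity, (show f =ᶠ[𝓝 t] fun _ => 0 from ht).deriv_eq, deriv_const, hgt]
  simp

/-- The invariant `W |g|^γ` is used in squared form to avoid signs. As `γ > 0` it vanishes at zeros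
of `g`, in particular at `0`. -/
theorem angularVorticity_eq_zero_of_abs_lt_one (h : ProfileSystem α c f g) (hα : -1 < α)
    (hα' : α < 1) (hg0 : g 0 = 0) (θ : ℝ) : angularVorticity α f g θ = 0 := by
  refine eq_zero_of_mul_eq_zero_of_local h.continuous_angularVorticity (g := g) (fun θ => ?_)
    (fun θ hθ => (h.angularVorticity_eq_zero_of_eventually hα'.ne hθ).self_of_nhds) θ
  set W := angularVorticity α f g with hW
  set γ := (1 + α) / (1 - α) with hγ
  have hα1 : 1 - α ≠ 0 := by linarith
  have hγ0 : 0 < γ := div_pos (by linarith) (by linarith)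
  -- This relation determines `γ`: it makes the two terms in the derivative of `(g W)² (g²)^(γ-1)`
  -- cancel.
  have hγα : (γ - 1) * (α - 1) = -2 * α := by
    rw [hγ]; field_simp; ring
  have key := eq_zero_of_hasDerivAt_zero_of_ne (Ψ := fun t => W t ^ 2 * (g t ^ 2) ^ γ) (a := 0)
    ?_ ?_ ?_ θ
  · rcases mul_eq_zero.1 key with h1 | h1
    · rw [pow_eq_zero_iff two_ne_zero] at h1
      simp [h1]
    · rw [Real.rpow_eq_zero (sq_nonneg _) hγ0.ne', pow_eq_zero_iff two_ne_zero] at h1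
      simp [h1]
  · exact (h.continuous_angularVorticity.pow 2).mul
      ((h.contDiff_snd.continuous.pow 2).rpow_const fun _ => Or.inr hγ0.le)
  · simp [hg0, Real.zero_rpow hγ0.ne']
  · intro t ht
    have hgt : g t ≠ 0 := by
      intro h0
      apply ht
      simp [h0, Real.zero_rpow hγ0.ne']
    have hgt2 : 0 < g t ^ 2 := by positivity
    -- Away from zeros of `g`, the invariant is rewritten as `(g W)² (g²)^(γ-1)`, so that only `g W`
    -- and `g` are differentiated.
    have d1 := ((h.hasDerivAt_mul_angularVorticity t).fun_pow 2).fun_mul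
      (((h.hasDerivAt_snd t).fun_pow 2).rpow_const (p := γ - 1) (Or.inl hgt2.ne'))
    refine (d1.congr_of_eventuallyEq ?_).congr_deriv ?_
    · filter_upwards [h.contDiff_snd.continuous.continuousAt.eventually_ne hgt] with s hs
      have : 0 < g s ^ 2 := by positivity
      rw [Real.rpow_sub_one this.ne', hW]
      field_simp
    · have hq : (g t ^ 2) ^ (γ - 1) = (g t ^ 2) ^ (γ - 1 - 1) * g t ^ 2 := by
        rw [← Real.rpow_add_one hgt2.ne', sub_add_cancel]
      rw [hq, ← hW]
      norm_num
      linear_combination (2 * (g t ^ 2) ^ (γ - 1 - 1) * g t ^ 3 * f t * W t ^ 2) * hγα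

theorem angularVorticity_eq_zero_of_eq_one (h : ProfileSystem 1 c f g) (hg0 : g 0 = 0) (θ : ℝ) :
    angularVorticity 1 f g θ = 0 := by
  have hg : ∀ t, g t = 0 := fun t => by
    rw [is_const_of_deriv_eq_zero (h.contDiff_snd.differentiable one_ne_zero)
      (fun t => by rw [h.continuity]; ring) t 0, hg0]
  have hf : ∀ t, f t ^ 2 = -2 * c := fun t => by
    have := h.momentum t
    rw [hg] at this
    linarith
  have hd := ((h.hasDerivAt_fst θ).fun_pow 2).unique
    ((hasDerivAt_const θ (-2 * c)).congr_of_eventuallyEq (Filter.Eventually.of_forall hf))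
  rw [angularVorticity, hg]
  by_cases h0 : f θ = 0
  · have hc : c = 0 := by
      have := hf θ
      rw [h0] at this
      linarith
    have hf0 : f = fun _ => 0 := funext fun t => by
      have := hf t
      rw [hc] at this
      simpa using this
    simp [hf0]
  · have : deriv f θ = 0 := by simpa [h0] using hd
    simp [this]

/-- Here `(g W)' = g' W`, so `g W' = 0`. Where `W' ≠ 0`, `g` and hence `W` would vanish locally, a
contradiction; so `W` is constant, equal to `2 g 0 - f' 0 = 0`. -/
theorem angularVorticity_eq_zero_of_eq_neg_one (h : ProfileSystem (-1) c f g)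
    (hf2 : ContDiff ℝ 2 f) (hg0 : g 0 = 0) (hf0 : deriv f 0 = 0) (θ : ℝ) :
    angularVorticity (-1) f g θ = 0 := by
  set W := angularVorticity (-1) f g with hW
  have hWd : ContDiff ℝ 1 W :=
    (contDiff_const.mul h.contDiff_snd).sub (hf2.deriv' (n := 1))
  have hd : ∀ t, deriv W t = 0 := by
    refine eq_zero_of_mul_eq_zero_of_local (hWd.continuous_deriv le_rfl) (g := g) (fun t => ?_)
      (fun t ht => ?_)
    · have h1 := (h.hasDerivAt_mul_angularVorticity t).unique
        ((h.hasDerivAt_snd t).fun_mul ((hWd.differentiable one_ne_zero) t).hasDerivAt)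
      rw [← hW] at h1
      linarith
    · have h1 := h.angularVorticity_eq_zero_of_eventually (by norm_num) ht
      rw [(show W =ᶠ[nhds t] fun _ => 0 from h1).deriv_eq, deriv_const]
  rw [is_const_of_deriv_eq_zero (hWd.differentiable one_ne_zero) hd θ 0, hW, angularVorticity,
    hg0, hf0]
  simp

end ProfileSystem

/-! ### From flows to profiles: nonexistence -/

theorem reflectPlane_unitVec (θ : ℝ) : reflectPlane (unitVec θ) = unitVec (-θ) := by
  simp [reflectPlane, unitVec]

theorem contDiffOn_norm_rpow (s : ℝ) {n : ℕ∞} :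
    ContDiffOn ℝ n (fun x : Plane => ‖x‖ ^ s) {0}ᶜ := fun _ hx =>
  ((contDiffAt_id.norm ℝ hx).rpow_const_of_ne (norm_ne_zero_iff.2 hx)).contDiffWithinAt

namespace IsReflSymmHomogeneousEulerSolution

variable {α : ℝ} {u : Plane → Plane} {p : Plane → ℝ}

theorem velocity_smul (h : IsReflSymmHomogeneousEulerSolution {0}ᶜ α u p) {r : ℝ} (hr : 0 < r)
    (θ : ℝ) : u (r • unitVec θ) = r ^ (-α) • u (unitVec θ) := by
  rw [h.velocity_homogeneous r hr (unitVec θ) (by simpa using smul_unitVec_ne_zero one_pos θ),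
    smul_smul, ← Real.rpow_add hr]
  simp

theorem exists_pressure (h : IsReflSymmHomogeneousEulerSolution {0}ᶜ α u p) :
    ∃ c, ∀ x ≠ 0, p x = ‖x‖ ^ (-(2 * α)) * c := by
  obtain ⟨c, hc⟩ := h.pressure_const
  refine ⟨c, fun x hx => ?_⟩
  rw [← hc x hx, ← mul_assoc, ← Real.rpow_add (norm_pos_iff.2 hx)]
  simp

/-- The angular profiles of the velocity solve the profile system, and the vorticity is given by
the angular vorticity. -/
theorem exists_profileSystem (h : IsReflSymmHomogeneousEulerSolution {0}ᶜ α u p)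
    (hu : ContDiffOn ℝ 1 u {0}ᶜ) :
    ∃ (c : ℝ) (f g : ℝ → ℝ), ProfileSystem α c f g ∧
      (∀ n : ℕ∞, ContDiffOn ℝ n u {0}ᶜ → ContDiff ℝ n f) ∧ g 0 = 0 ∧ deriv f 0 = 0 ∧
      ((∀ θ, ProfileSystem.angularVorticity α f g θ = 0) → ¬ IsRotational u) := by
  obtain ⟨c, hp⟩ := h.exists_pressure
  have hprof : ∀ i, ∀ r > 0, ∀ θ, u (r • unitVec θ) i = r ^ (-α) * u (unitVec θ) i :=
    fun i r hr θ => by rw [h.velocity_smul hr]; rfl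
  have hsm : ∀ n : ℕ∞, ContDiffOn ℝ n u {0}ᶜ → ∀ i, ContDiff ℝ n (fun θ => u (unitVec θ) i) :=
    fun n hn i => contDiff_profile (hprof i) ((contDiffOn_euclidean.1 hn) i)
  set f : ℝ → ℝ := fun θ => u (unitVec θ) 0 * Real.cos θ + u (unitVec θ) 1 * Real.sin θ with hf
  set g : ℝ → ℝ := fun θ => u (unitVec θ) 1 * Real.cos θ - u (unitVec θ) 0 * Real.sin θ with hg
  have hfn : ∀ n : ℕ∞, ContDiffOn ℝ n u {0}ᶜ → ContDiff ℝ n f := fun n hn =>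
    ((hsm n hn 0).mul Real.contDiff_cos).add ((hsm n hn 1).mul Real.contDiff_sin)
  have hgn : ContDiff ℝ 1 g :=
    ((hsm 1 hu 1).mul Real.contDiff_cos).sub ((hsm 1 hu 0).mul Real.contDiff_sin)
  have hu0 : ∀ r > 0, ∀ θ, u (r • unitVec θ) 0 =
      r ^ (-α) * (f θ * Real.cos θ - g θ * Real.sin θ) := fun r hr θ => by
    rw [hprof 0 r hr, hf, hg]
    linear_combination -(r ^ (-α) * u (unitVec θ) 0) * Real.sin_sq_add_cos_sq θ
  have hu1 : ∀ r > 0, ∀ θ, u (r • unitVec θ) 1 =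
      r ^ (-α) * (f θ * Real.sin θ + g θ * Real.cos θ) := fun r hr θ => by
    rw [hprof 1 r hr, hf, hg]
    linear_combination -(r ^ (-α) * u (unitVec θ) 1) * Real.sin_sq_add_cos_sq θ
  have hpp : ∀ r > 0, ∀ θ, p (r • unitVec θ) = r ^ (-(2 * α)) * c := fun r hr θ => by
    rw [hp _ (smul_unitVec_ne_zero hr θ), norm_smul_unitVec hr]
  have hdp : ContDiffOn ℝ 1 p {0}ᶜ :=
    ((contDiffOn_norm_rpow (n := 1) (-(2 * α))).mul contDiffOn_const).congr hp
  have hfd : ∀ θ, HasDerivAt f (deriv f θ) θ := fun θ =>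
    (((hfn 1 hu).differentiable one_ne_zero) θ).hasDerivAt
  have hgd : ∀ θ, HasDerivAt g (deriv g θ) θ := fun θ =>
    ((hgn.differentiable one_ne_zero) θ).hasDerivAt
  have heuler := (isEulerSolution_iff_pointwise isOpen_compl_singleton hu hdp).1 h.euler
  have hpolar := fun r (hr : 0 < r) θ =>
    euler_polar hu0 hu1 hpp hu hdp hr (hfd θ) (hgd θ)
  have hsys : ∀ θ, _ := fun θ =>
    (hpolar 1 one_pos θ).1.1 (heuler _ (smul_unitVec_ne_zero one_pos θ))
  have hmem : ∀ θ, unitVec θ ∈ ({0}ᶜ : Set Plane) := fun θ => by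
    simpa using smul_unitVec_ne_zero one_pos θ
  refine ⟨c, f, g, ⟨hfn 1 hu, hgn, fun θ => (hsys θ).1, fun θ => (hsys θ).2⟩, hfn, ?_, ?_, ?_⟩
  · have := h.velocity_symm_snd (unitVec 0) (hmem 0)
    rw [reflectPlane_unitVec, neg_zero] at this
    simp only [hg, Real.cos_zero, Real.sin_zero]
    linarith
  · have heven : ∀ θ, f (-θ) = f θ := fun θ => by
      have e0 := h.velocity_symm_fst (unitVec θ) (hmem θ)
      have e1 := h.velocity_symm_snd (unitVec θ) (hmem θ)
      rw [reflectPlane_unitVec] at e0 e1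
      simp only [hf, Real.cos_neg, Real.sin_neg, e0, e1]
      ring
    have h1 := deriv_comp_neg f 0
    simp only [heven, neg_zero] at h1
    linarith
  · rintro hW ⟨x, hx, hrot⟩
    apply hrot
    have := (hpolar ‖x‖ (norm_pos_iff.2 hx) (polarAngle x)).2
    rw [norm_smul_unitVec_polarAngle] at this
    rw [this, ← ProfileSystem.angularVorticity, hW, mul_zero]

theorem not_isRotational_of_le_one (h : IsReflSymmHomogeneousEulerSolution {0}ᶜ α u p)
    (hu : ContDiffOn ℝ 1 u {0}ᶜ) (hα : -1 < α) (hα' : α ≤ 1) : ¬ IsRotational u := by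
  obtain ⟨c, f, g, hs, -, hg0, -, hrot⟩ := h.exists_profileSystem hu
  apply hrot
  rcases hα'.eq_or_lt with rfl | hlt
  · exact hs.angularVorticity_eq_zero_of_eq_one hg0
  · exact hs.angularVorticity_eq_zero_of_abs_lt_one hα hlt hg0

theorem not_isRotational_of_eq_neg_one (h : IsReflSymmHomogeneousEulerSolution {0}ᶜ (-1) u p)
    (hu : ContDiffOn ℝ 2 u {0}ᶜ) : ¬ IsRotational u := by
  obtain ⟨c, f, g, hs, hf, hg0, hf0, hrot⟩ :=
    h.exists_profileSystem (hu.of_le one_le_two)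
  exact hrot (hs.angularVorticity_eq_zero_of_eq_neg_one (hf 2 hu) hg0 hf0)

end IsReflSymmHomogeneousEulerSolution

/-! ### Shear flows, for `α < -1` -/

theorem contDiff_abs_rpow {s : ℝ} (hs : 1 < s) : ContDiff ℝ 1 (fun t : ℝ => |t| ^ s) := by
  simpa using contDiff_norm_rpow (E := ℝ) hs

/-- The shear flow `(|x₂| ^ s, 0)`. -/
def shearFlow (s : ℝ) (x : Plane) : Plane := !₂[|x 1| ^ s, 0]

theorem contDiff_shearFlow {s : ℝ} (hs : 1 < s) : ContDiff ℝ 1 (shearFlow s) := by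
  rw [contDiff_euclidean]
  intro i
  fin_cases i
  · exact (contDiff_abs_rpow hs).comp (contDiff_euclidean.1 contDiff_id 1)
  · exact contDiff_const

theorem partialDeriv_shearFlow {s : ℝ} (hs : 1 < s) (x : Plane) :
    partialDeriv 0 (fun y => shearFlow s y 0) x = 0 ∧
    partialDeriv 1 (fun y => shearFlow s y 0) x = s * |x 1| ^ (s - 2) * x 1 ∧
    ∀ i, partialDeriv i (fun y => shearFlow s y 1) x = 0 := by
  have h1 : HasFDerivAt (fun y : Plane => y 1)
      (EuclideanSpace.proj (1 : Fin 2) : Plane →L[ℝ] ℝ) x :=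
    (EuclideanSpace.proj (1 : Fin 2) : Plane →L[ℝ] ℝ).hasFDerivAt
  have h2 := (hasDerivAt_abs_rpow (x 1) hs).comp_hasFDerivAt x h1
  have h3 : (fun y => shearFlow s y 0) = (fun t : ℝ => |t| ^ s) ∘ fun y : Plane => y 1 := rfl
  rw [← h3] at h2
  refine ⟨?_, ?_, fun i => ?_⟩
  · rw [partialDeriv, h2.fderiv]; simp
  · rw [partialDeriv, h2.fderiv]; simp
  · simp [partialDeriv, shearFlow]

theorem shearFlow_isRotational {s : ℝ} (hs : 1 < s) : IsRotational (shearFlow s) := by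
  refine ⟨EuclideanSpace.single 1 1, by simp, ?_⟩
  obtain ⟨-, h1, h2⟩ := partialDeriv_shearFlow hs (EuclideanSpace.single 1 1)
  rw [vorticity, h1, h2]
  simp
  positivity

/-- The field points along `x₁` and depends on `x₂` alone, so its divergence and `u · ∇u` both
vanish. For `s > 1` it is `C¹` through the origin, so the pointwise criterion applies on the whole
plane. -/
theorem shearFlow_isReflSymmHomogeneousEulerSolution {s : ℝ} (hs : 1 < s) :
    IsReflSymmHomogeneousEulerSolution Set.univ (-s) (shearFlow s) 0 where
  euler := by
    rw [isEulerSolution_iff_pointwise isOpen_univ (contDiff_shearFlow hs).contDiffOn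
      (p := 0) (contDiffOn_const (c := (0 : ℝ)))]
    intro x _
    obtain ⟨h0, h1, h2⟩ := partialDeriv_shearFlow hs x
    have hp : ∀ i, partialDeriv i 0 x = 0 := fun i => by simp [partialDeriv]
    refine ⟨by rw [planeDiv, Fin.sum_univ_two, h0, h2, add_zero], ?_⟩
    rw [Fin.forall_fin_two, Fin.sum_univ_two, Fin.sum_univ_two, h0, h2, h2, hp, hp]
    simp [shearFlow]
  velocity_homogeneous l hl x _ := by
    ext i
    fin_cases i
    · simp [shearFlow, abs_mul, abs_of_pos hl, Real.mul_rpow hl.le (abs_nonneg _), ← mul_assoc,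
        ← Real.rpow_add hl]
    · simp [shearFlow]
  pressure_homogeneous := by simp
  velocity_symm_fst x _ := by simp [shearFlow, reflectPlane]
  velocity_symm_snd x _ := by simp [shearFlow]
  pressure_symm := by simp
  pressure_const := ⟨0, by simp⟩

/-! ### From periodic profiles to flows -/

theorem Function.Periodic.eq_of_angle_eq {F : ℝ → ℝ} (hF : Function.Periodic F (2 * Real.pi))
    {a b : ℝ} (h : (a : Real.Angle) = b) : F a = F b := by
  obtain ⟨k, hk⟩ := Real.Angle.angle_eq_iff_two_pi_dvd_sub.1 h
  rw [show a = b + k * (2 * Real.pi) by linarith, hF.int_mul k]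

theorem polarAngle_smul_unitVec {r : ℝ} (hr : 0 < r) (θ : ℝ) :
    (polarAngle (r • unitVec θ) : Real.Angle) = θ := by
  have h : (⟨(r • unitVec θ) 0, (r • unitVec θ) 1⟩ : ℂ) =
      r * (Real.Angle.cos θ + Real.Angle.sin θ * Complex.I) := by
    apply Complex.ext <;> simp [Complex.cos_ofReal_re, Complex.sin_ofReal_re]
  rw [polarAngle, h, Complex.arg_mul_cos_add_sin_mul_I_coe_angle hr]

/-- The homogeneous function of degree `s` with angular profile `F`. -/
def homogeneousExt (s : ℝ) (F : ℝ → ℝ) (x : Plane) : ℝ := ‖x‖ ^ s * F (polarAngle x)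

theorem homogeneousExt_smul_unitVec (s : ℝ) {F : ℝ → ℝ}
    (hF : Function.Periodic F (2 * Real.pi)) {r : ℝ} (hr : 0 < r) (θ : ℝ) :
    homogeneousExt s F (r • unitVec θ) = r ^ s * F θ := by
  rw [homogeneousExt, norm_smul_unitVec hr, hF.eq_of_angle_eq (polarAngle_smul_unitVec hr θ)]

theorem Complex.contDiffAt_arg_of_mem_slitPlane {z : ℂ} (hz : z ∈ Complex.slitPlane) {n : ℕ∞} :
    ContDiffAt ℝ n Complex.arg z := by
  have h : ContDiffAt ℝ n (Complex.imCLM ∘ Complex.log) z :=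
    Complex.imCLM.contDiff.contDiffAt.comp z ((Complex.contDiffAt_log hz).restrict_scalars ℝ)
  refine h.congr_of_eventuallyEq (Filter.Eventually.of_forall fun w => ?_)
  simp [Complex.log_im]

theorem contDiffOn_homogeneousExt (s : ℝ) {F : ℝ → ℝ}
    (hF : Function.Periodic F (2 * Real.pi)) {n : ℕ∞} (hn : ContDiff ℝ n F) :
    ContDiffOn ℝ n (homogeneousExt s F) {0}ᶜ := by
  refine (contDiffOn_norm_rpow s).mul fun x hx => ContDiffAt.contDiffWithinAt ?_
  set Z : Plane → ℂ := fun x => ⟨x 0, x 1⟩ with hZ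
  have hZd : ContDiff ℝ n Z := by
    have : Z = fun x => (x 0 : ℂ) + (x 1 : ℂ) * Complex.I := by
      ext x; apply Complex.ext <;> simp [hZ]
    rw [this]
    exact (Complex.ofRealCLM.contDiff.comp (contDiff_euclidean.1 contDiff_id 0)).add
      ((Complex.ofRealCLM.contDiff.comp (contDiff_euclidean.1 contDiff_id 1)).mul contDiff_const)
  have hZ0 : Z x ≠ 0 := by
    intro h0
    apply hx
    have h1 := Complex.ext_iff.1 h0
    ext i
    fin_cases i
    · exact h1.1
    · exact h1.2
  rcases Complex.mem_slitPlane_or_neg_mem_slitPlane hZ0 with h | h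
  · exact hn.contDiffAt.comp x
      ((Complex.contDiffAt_arg_of_mem_slitPlane h).comp x hZd.contDiffAt)
  -- Near the branch cut, `arg (-z) + π` is a smooth angle that agrees with `arg z` modulo `2π`;
  -- periodicity of `F` hides the difference.
  · have h1 : ContDiffAt ℝ n (fun y => F (Complex.arg (-Z y) + Real.pi)) x :=
      hn.contDiffAt.comp x (((Complex.contDiffAt_arg_of_mem_slitPlane h).comp x
        hZd.neg.contDiffAt).add contDiffAt_const)
    refine h1.congr_of_eventuallyEq ?_
    filter_upwards [hZd.continuous.continuousAt.eventually_ne hZ0] with y hy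
    apply hF.eq_of_angle_eq
    rw [Real.Angle.coe_add, Complex.arg_neg_coe_angle hy, add_assoc, Real.Angle.coe_pi_add_coe_pi,
      add_zero]
    rfl

theorem exists_smul_unitVec {x : Plane} (hx : x ∈ ({0}ᶜ : Set Plane)) :
    ∃ r > (0 : ℝ), ∃ θ, x = r • unitVec θ :=
  ⟨‖x‖, norm_pos_iff.2 hx, polarAngle x, (norm_smul_unitVec_polarAngle x).symm⟩

theorem reflectPlane_smul_unitVec (r θ : ℝ) :
    reflectPlane (r • unitVec θ) = r • unitVec (-θ) := by
  ext i; fin_cases i <;> simp [reflectPlane]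

theorem homogeneousExt_eq_rpow_mul (s : ℝ) {F : ℝ → ℝ} (hF : Function.Periodic F (2 * Real.pi))
    {l : ℝ} (hl : 0 < l) {x : Plane} (hx : x ∈ ({0}ᶜ : Set Plane)) :
    homogeneousExt s F x = l ^ (-s) * homogeneousExt s F (l • x) := by
  obtain ⟨r, hr, θ, rfl⟩ := exists_smul_unitVec hx
  rw [smul_smul, homogeneousExt_smul_unitVec s hF hr,
    homogeneousExt_smul_unitVec s hF (mul_pos hl hr), Real.mul_rpow hl.le hr.le, ← mul_assoc,
    ← mul_assoc, ← Real.rpow_add hl]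
  simp

/-- A `2π`-periodic solution of the profile system with even `f` and odd `g` gives a reflection
symmetric homogeneous Euler flow. -/
theorem ProfileSystem.exists_isReflSymmHomogeneousEulerSolution {α c : ℝ} {f g : ℝ → ℝ}
    (h : ProfileSystem α c f g) {n : ℕ∞} (hn : 1 ≤ n) (hf : ContDiff ℝ n f) (hg : ContDiff ℝ n g)
    (hfp : Function.Periodic f (2 * Real.pi)) (hgp : Function.Periodic g (2 * Real.pi))
    (hfe : ∀ θ, f (-θ) = f θ) (hgo : ∀ θ, g (-θ) = -g θ)
    (hW : ∃ θ, angularVorticity α f g θ ≠ 0) :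
    ∃ (u : Plane → Plane) (p : Plane → ℝ), IsReflSymmHomogeneousEulerSolution {0}ᶜ α u p ∧
      ContDiffOn ℝ n u {0}ᶜ ∧ IsRotational u := by
  set F0 : ℝ → ℝ := fun θ => f θ * Real.cos θ - g θ * Real.sin θ with hF0
  set F1 : ℝ → ℝ := fun θ => f θ * Real.sin θ + g θ * Real.cos θ with hF1
  have p0 : Function.Periodic F0 (2 * Real.pi) :=
    (hfp.mul Real.cos_periodic).sub (hgp.mul Real.sin_periodic)
  have p1 : Function.Periodic F1 (2 * Real.pi) :=
    (hfp.mul Real.sin_periodic).add (hgp.mul Real.cos_periodic)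
  set u : Plane → Plane := fun x => !₂[homogeneousExt (-α) F0 x, homogeneousExt (-α) F1 x] with hu
  set p : Plane → ℝ := homogeneousExt (-(2 * α)) (fun _ => c) with hp
  have pc : Function.Periodic (fun _ : ℝ => c) (2 * Real.pi) := fun _ => rfl
  have hdu : ContDiffOn ℝ n u {0}ᶜ := by
    rw [contDiffOn_euclidean, Fin.forall_fin_two]
    exact ⟨contDiffOn_homogeneousExt _ p0
        ((hf.mul Real.contDiff_cos).sub (hg.mul Real.contDiff_sin)),
      contDiffOn_homogeneousExt _ p1
        ((hf.mul Real.contDiff_sin).add (hg.mul Real.contDiff_cos))⟩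
  have hdu1 : ContDiffOn ℝ 1 u {0}ᶜ := hdu.of_le (by exact_mod_cast hn)
  have hdp : ContDiffOn ℝ 1 p {0}ᶜ :=
    contDiffOn_homogeneousExt (n := 1) _ pc contDiff_const
  have hpolar := fun r (hr : (0 : ℝ) < r) θ => euler_polar (u := u) (p := p)
    (fun r hr θ => homogeneousExt_smul_unitVec (-α) p0 hr θ)
    (fun r hr θ => homogeneousExt_smul_unitVec (-α) p1 hr θ)
    (fun r hr θ => homogeneousExt_smul_unitVec _ pc hr θ) hdu1 hdp hr
    (h.hasDerivAt_fst θ) (h.hasDerivAt_snd θ)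
  refine ⟨u, p, ?_, hdu, ?_⟩
  · constructor
    · rw [isEulerSolution_iff_pointwise isOpen_compl_singleton hdu1 hdp]
      intro x hx
      obtain ⟨r, hr, θ, rfl⟩ := exists_smul_unitVec hx
      exact (hpolar r hr θ).1.2 ⟨rfl, h.momentum θ⟩
    · intro l hl x hx
      ext i
      fin_cases i
      · simpa [hu] using homogeneousExt_eq_rpow_mul (-α) p0 hl hx
      · simpa [hu] using homogeneousExt_eq_rpow_mul (-α) p1 hl hx
    · intro l hl x hx
      simpa using homogeneousExt_eq_rpow_mul (-(2 * α)) pc hl hx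
    · intro x hx
      obtain ⟨r, hr, θ, rfl⟩ := exists_smul_unitVec hx
      rw [reflectPlane_smul_unitVec]
      change homogeneousExt (-α) F0 _ = homogeneousExt (-α) F0 _
      rw [homogeneousExt_smul_unitVec (-α) p0 hr, homogeneousExt_smul_unitVec (-α) p0 hr]
      simp [hF0, hfe, hgo]
    · intro x hx
      obtain ⟨r, hr, θ, rfl⟩ := exists_smul_unitVec hx
      rw [reflectPlane_smul_unitVec]
      change homogeneousExt (-α) F1 _ = -homogeneousExt (-α) F1 _
      rw [homogeneousExt_smul_unitVec (-α) p1 hr, homogeneousExt_smul_unitVec (-α) p1 hr]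
      simp [hF1, hfe, hgo]
      ring
    · intro x hx
      obtain ⟨r, hr, θ, rfl⟩ := exists_smul_unitVec hx
      rw [reflectPlane_smul_unitVec, hp, homogeneousExt_smul_unitVec _ pc hr,
        homogeneousExt_smul_unitVec _ pc hr]
    · refine ⟨c, fun x hx => ?_⟩
      rw [hp, homogeneousExt, ← mul_assoc, ← Real.rpow_add (norm_pos_iff.2 hx)]
      simp
  · obtain ⟨θ, hθ⟩ := hW
    refine ⟨(1 : ℝ) • unitVec θ, smul_unitVec_ne_zero one_pos θ, ?_⟩
    rw [(hpolar 1 one_pos θ).2]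
    simpa [angularVorticity] using hθ

/-! ### Periodic rotational profiles for `α > 1` -/

open Filter Topology

/-- The slope of `f²` is the slope of `f` times `f t + f θ`, which has a nonzero limit. This
recovers `f'` from the conserved quantity wherever `f ≠ 0`. -/
theorem hasDerivAt_of_hasDerivAt_sq {f : ℝ → ℝ} {N θ : ℝ} (hc : ContinuousAt f θ)
    (hne : f θ ≠ 0) (hd : HasDerivAt (fun t => f t ^ 2) (2 * f θ * N) θ) : HasDerivAt f N θ := by
  rw [hasDerivAt_iff_tendsto_slope] at hd ⊢
  have h1 : Tendsto (fun t => f t + f θ) (𝓝[≠] θ) (𝓝 (f θ + f θ)) :=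
    (hc.tendsto.mono_left nhdsWithin_le_nhds).add_const _
  have h2ne : f θ + f θ ≠ 0 := by
    rw [← two_mul]; exact mul_ne_zero two_ne_zero hne
  have h2 := hd.div h1 h2ne
  rw [show 2 * f θ * N / (f θ + f θ) = N by field_simp; ring] at h2
  refine h2.congr' ?_
  filter_upwards [h1.eventually_ne h2ne] with t ht
  rw [Pi.div_apply, slope_def_field, slope_def_field]
  field_simp
  ring

/-- A product rule with `S` only continuous, for the turning points `f = 0`, where `S` is not known
to be differentiable. -/
theorem hasDerivAt_mul_of_eq_zero {h S : ℝ → ℝ} {h' θ : ℝ} (hd : HasDerivAt h h' θ)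
    (h0 : h θ = 0) (hS : ContinuousAt S θ) : HasDerivAt (fun t => h t * S t) (h' * S θ) θ := by
  rw [hasDerivAt_iff_tendsto_slope] at hd ⊢
  refine (hd.mul (hS.tendsto.mono_left nhdsWithin_le_nhds)).congr fun t => ?_
  rw [slope_def_field, slope_def_field, h0]
  ring

theorem abs_rpow_two_add {q : ℝ} {y : ℝ} (hy : y ≠ 0) : |y| ^ (q + 2) = |y| ^ q * y ^ 2 := by
  rw [Real.rpow_add (abs_pos.2 hy), Real.rpow_two, sq_abs]

theorem hasDerivAt_abs_rpow_mul_self {q : ℝ} (hq : 0 < q) (y : ℝ) :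
    HasDerivAt (fun t : ℝ => |t| ^ q * t) ((q + 1) * |y| ^ q) y := by
  have hc : Continuous fun t : ℝ => |t| ^ q := continuous_abs.rpow_const fun _ => Or.inr hq.le
  refine hasDerivAt_of_hasDerivAt_of_ne' (x := 0) (g := fun y => (q + 1) * |y| ^ q)
    (fun y hy => ?_) (hc.mul continuous_id).continuousAt (continuous_const.mul hc).continuousAt y
  have h1 := (hasDerivAt_abs_rpow y (p := q + 2) (by linarith)).fun_div (hasDerivAt_id y) hy
  refine (h1.congr_of_eventuallyEq ?_).congr_deriv ?_
  · filter_upwards [isOpen_ne.mem_nhds hy] with t ht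
    simp only [abs_rpow_two_add ht, id]
    field_simp
    rfl
  · rw [abs_rpow_two_add hy]
    simp
    field_simp
    ring

/-- Inverting the primitive of a positive even periodic function. -/
theorem exists_phase {Q : ℝ → ℝ} {T P : ℝ} (hc : Continuous Q) (hpos : ∀ x, 0 < Q x)
    (heven : ∀ x, Q (-x) = Q x) (hper : Function.Periodic Q T) (hT : 0 < T)
    (hint : ∫ x in 0..T, Q x = P) :
    ∃ φ : ℝ → ℝ, (∀ θ, HasDerivAt φ (Q (φ θ))⁻¹ θ) ∧ (∀ θ, φ (-θ) = -φ θ) ∧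
      (∀ θ, φ (θ + P) = φ θ + T) ∧ Function.Surjective φ := by
  have hii : ∀ a b, IntervalIntegrable Q volume a b := fun a b => hc.intervalIntegrable a b
  -- `Θ x` is the time needed to reach phase `x`; its inverse solves `φ' = 1 / Q(φ)`.
  set Θ : ℝ → ℝ := fun x => ∫ t in 0..x, Q t with hΘ
  have hder : ∀ x, HasDerivAt Θ (Q x) x := fun x => hc.integral_hasStrictDerivAt 0 x |>.hasDerivAt
  have hmono : StrictMono Θ := strictMono_of_deriv_pos fun x => by
    rw [(hder x).deriv]; exact hpos x
  have hcΘ : Continuous Θ := continuous_iff_continuousAt.2 fun x => (hder x).continuousAt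
  have hsurj : Function.Surjective Θ := hcΘ.surjective
    (hper.tendsto_atTop_intervalIntegral_of_pos' (hii 0 T) hpos hT)
    (hper.tendsto_atBot_intervalIntegral_of_pos' (hii 0 T) hpos hT)
  set e := StrictMono.orderIsoOfSurjective Θ hmono hsurj with he
  have hleft : ∀ x, e.symm (Θ x) = x := fun x => e.symm_apply_apply x
  have hright : ∀ θ, Θ (e.symm θ) = θ := fun θ => e.apply_symm_apply θ
  refine ⟨e.symm, fun θ => ?_, fun θ => ?_, fun θ => ?_, e.symm.surjective⟩
  · exact HasDerivAt.of_local_left_inverse e.symm.continuous.continuousAt (hder _)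
      (hpos _).ne' (Eventually.of_forall hright)
  · apply hmono.injective
    rw [hright]
    have h1 : ∀ x, Θ (-x) = -Θ x := fun x => by
      have := intervalIntegral.integral_comp_neg (a := 0) (b := x) Q
      simp only [heven, neg_zero] at this
      rw [hΘ]
      simp only
      rw [intervalIntegral.integral_symm, ← this]
    rw [h1, hright]
  · apply hmono.injective
    rw [hright]
    have h1 : ∀ x, Θ (x + T) = Θ x + P := fun x => by
      have := hper.intervalIntegral_add_eq_add 0 x hii
      simp only [zero_add] at this
      rw [hint] at this
      exact this
    rw [h1, hright]

/-- The quotient `(1 - x ^ b) / (1 - x)`, extended continuously to `x = 1`, at `x = sin² φ`. -/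
def powerQuotient (b φ : ℝ) : ℝ := dslope (fun x : ℝ => x ^ b) 1 (Real.sin φ ^ 2)

theorem continuous_powerQuotient {b : ℝ} (hb : 0 ≤ b) : Continuous (powerQuotient b) := by
  have h : Continuous (dslope (fun x : ℝ => x ^ b) 1) := by
    rw [← continuousOn_univ, continuousOn_dslope univ_mem, continuousOn_univ]
    exact ⟨Real.continuous_rpow_const hb,
      (Real.hasDerivAt_rpow_const (Or.inl one_ne_zero)).differentiableAt⟩
  exact h.comp (Real.continuous_sin.pow 2)

theorem cos_sq_mul_powerQuotient (b φ : ℝ) :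
    Real.cos φ ^ 2 * powerQuotient b φ = 1 - (Real.sin φ ^ 2) ^ b := by
  have h := sub_smul_dslope (fun x : ℝ => x ^ b) 1 (Real.sin φ ^ 2)
  rw [smul_eq_mul, Real.one_rpow] at h
  rw [powerQuotient, Real.cos_sq']
  linarith

theorem powerQuotient_of_cos_eq_zero (b : ℝ) {φ : ℝ} (h : Real.cos φ = 0) :
    powerQuotient b φ = b := by
  have h1 : Real.sin φ ^ 2 = 1 := by rw [Real.sin_sq, h]; simp
  rw [powerQuotient, h1, dslope_same]
  simp

theorem one_le_powerQuotient {b : ℝ} (hb : 1 ≤ b) (φ : ℝ) : 1 ≤ powerQuotient b φ := by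
  by_cases h : Real.cos φ = 0
  · rwa [powerQuotient_of_cos_eq_zero b h]
  · have hpos : 0 < Real.cos φ ^ 2 := by positivity
    have h1 : (Real.sin φ ^ 2) ^ b ≤ Real.sin φ ^ 2 := by
      have := Real.rpow_le_rpow_of_exponent_ge_of_imp (sq_nonneg (Real.sin φ))
        (Real.sin_sq_le_one φ) hb (by intro _ h0; linarith)
      simpa using this
    have h2 := cos_sq_mul_powerQuotient b φ
    have h3 := Real.sin_sq_add_cos_sq φ
    refine le_of_mul_le_mul_left ?_ hpos
    linarith

theorem powerQuotient_neg (b φ : ℝ) : powerQuotient b (-φ) = powerQuotient b φ := by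
  simp [powerQuotient]

theorem powerQuotient_periodic (b : ℝ) : Function.Periodic (powerQuotient b) Real.pi := fun φ => by
  simp [powerQuotient]

/-- The amplitude factor `√(1 + a² R)`, with `R` the power quotient. -/
def phaseSpeed (b a φ : ℝ) : ℝ := √(1 + a ^ 2 * powerQuotient b φ)

theorem one_le_one_add_mul_powerQuotient {b : ℝ} (hb : 1 ≤ b) (a φ : ℝ) :
    1 + a ^ 2 ≤ 1 + a ^ 2 * powerQuotient b φ := by
  nlinarith [one_le_powerQuotient hb φ, sq_nonneg a]

theorem phaseSpeed_sq {b : ℝ} (hb : 1 ≤ b) (a φ : ℝ) :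
    phaseSpeed b a φ ^ 2 = 1 + a ^ 2 * powerQuotient b φ :=
  Real.sq_sqrt (by nlinarith [one_le_one_add_mul_powerQuotient hb a φ, sq_nonneg a])

theorem phaseSpeed_pos {b : ℝ} (hb : 1 ≤ b) (a φ : ℝ) : 0 < phaseSpeed b a φ :=
  Real.sqrt_pos.2 (by nlinarith [one_le_one_add_mul_powerQuotient hb a φ, sq_nonneg a])

theorem le_phaseSpeed {b : ℝ} (hb : 1 ≤ b) (a φ : ℝ) : a ≤ phaseSpeed b a φ :=
  Real.le_sqrt_of_sq_le (by linarith [one_le_one_add_mul_powerQuotient hb a φ])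

theorem continuous_phaseSpeed {b : ℝ} (hb : 1 ≤ b) :
    Continuous (Function.uncurry (phaseSpeed b)) :=
  (continuous_const.add ((continuous_fst.pow 2).mul
    ((continuous_powerQuotient (by linarith)).comp continuous_snd))).sqrt

/-- The half period can be tuned to be an integer fraction of `π`. -/
theorem exists_half_period {b κ : ℝ} (hb : 1 ≤ b) (hκ : 0 < κ) :
    ∃ a : ℝ, a ≠ 0 ∧ ∃ k : ℕ, 0 < k ∧
      ∫ φ in 0..Real.pi, (κ * phaseSpeed b a φ)⁻¹ = Real.pi / k := by
  obtain ⟨k, hk⟩ := exists_nat_gt κ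
  have hk0 : (0 : ℝ) < k := hκ.trans hk
  set T : ℝ → ℝ := fun a => ∫ φ in 0..Real.pi, (κ * phaseSpeed b a φ)⁻¹ with hT
  have hcu : Continuous (Function.uncurry fun a φ => (κ * phaseSpeed b a φ)⁻¹) :=
    (continuous_const.mul (continuous_phaseSpeed hb)).inv₀
      fun x => (mul_pos hκ (phaseSpeed_pos hb _ _)).ne'
  have hTc : Continuous T :=
    intervalIntegral.continuous_parametric_intervalIntegral_of_continuous' hcu 0 Real.pi
  have hT0 : T 0 = Real.pi / κ := by
    simp [hT, phaseSpeed, div_eq_mul_inv]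
  -- At `a = k/κ`, the bound `S ≥ a` makes the integrand at most `1/k`. At `a = 0` the value is `π/κ
  -- > π/k`, so an intermediate `a` works, and the strict inequality rules out `a = 0`.
  have hT1 : T (k / κ) ≤ Real.pi / k := by
    have h1 : T (k / κ) ≤ ∫ _ in 0..Real.pi, (k : ℝ)⁻¹ := by
      refine intervalIntegral.integral_mono Real.pi_pos.le
        ((hcu.comp (Continuous.prodMk_right (k / κ))).intervalIntegrable _ _)
        intervalIntegrable_const fun φ => ?_
      refine inv_anti₀ hk0 ?_
      have := mul_le_mul_of_nonneg_left (le_phaseSpeed hb (k / κ) φ) hκ.le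
      rwa [mul_div_cancel₀ _ hκ.ne'] at this
    simpa [div_eq_mul_inv] using h1
  have hlt : Real.pi / k < T 0 := by
    rw [hT0]; exact div_lt_div_of_pos_left Real.pi_pos hκ hk
  obtain ⟨a, -, ha⟩ := intermediate_value_Icc' (div_pos hk0 hκ).le hTc.continuousOn ⟨hT1, hlt.le⟩
  refine ⟨a, ?_, k, by exact_mod_cast hk0, ha⟩
  rintro rfl
  exact hlt.ne' ha

/-- For `α > 1` the profile system has rotational `2π`-periodic symmetric solutions. -/
theorem exists_rotational_profile {α : ℝ} (hα : 1 < α) :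
    ∃ (c : ℝ) (f g : ℝ → ℝ), ProfileSystem α c f g ∧ ContDiff ℝ 2 f ∧ ContDiff ℝ 2 g ∧
      Function.Periodic f (2 * Real.pi) ∧ Function.Periodic g (2 * Real.pi) ∧
      (∀ θ, f (-θ) = f θ) ∧ (∀ θ, g (-θ) = -g θ) ∧
      ∃ θ, ProfileSystem.angularVorticity α f g θ ≠ 0 := by
  set κ := α - 1 with hκ
  have hκ0 : 0 < κ := by linarith
  set b := α / κ with hb
  have hbκ : κ * b = α := mul_div_cancel₀ _ hκ0.ne'
  have hb1 : 1 < b := by rw [hb, lt_div_iff₀ hκ0]; linarith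
  obtain ⟨a, ha, k, hk, hint⟩ := exists_half_period hb1.le hκ0
  set S := phaseSpeed b a with hS
  have hSc : Continuous S := (continuous_phaseSpeed hb1.le).comp (Continuous.prodMk_right a)
  have hSpos : ∀ φ, 0 < S φ := phaseSpeed_pos hb1.le a
  have hSper : Function.Periodic S Real.pi := fun φ => by
    simp only [hS, phaseSpeed, powerQuotient_periodic b φ]
  have hSneg : ∀ φ, S (-φ) = S φ := fun φ => by
    simp only [hS, phaseSpeed, powerQuotient_neg]
  obtain ⟨φ, hφd, hφneg, hφadd, hφsurj⟩ := exists_phase (Q := fun x => (κ * S x)⁻¹)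
    ((continuous_const.mul hSc).inv₀ fun x => (mul_pos hκ0 (hSpos x)).ne')
    (fun x => inv_pos.2 (mul_pos hκ0 (hSpos x))) (fun x => by simp only [hSneg])
    (fun x => by simp only [hSper x]) Real.pi_pos hint
  simp only [inv_inv] at hφd
  have hφc : Continuous φ := continuous_iff_continuousAt.2 fun θ => (hφd θ).continuousAt
  -- The phase gains `π` over each `π/k`, hence `k` full turns over `2π`.
  have hφ2 : ∀ θ, φ (θ + 2 * Real.pi) = φ θ + k * (2 * Real.pi) := by
    have h1 : ∀ (n : ℕ) θ, φ (θ + n * (Real.pi / k)) = φ θ + n * Real.pi := by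
      intro n
      induction n with
      | zero => simp
      | succ n ih =>
        intro θ
        rw [show θ + (n + 1 : ℕ) * (Real.pi / k) = θ + n * (Real.pi / k) + Real.pi / k by
          push_cast; ring, hφadd, ih]
        push_cast; ring
    intro θ
    have hk' : (k : ℝ) ≠ 0 := by exact_mod_cast hk.ne'
    have := h1 (2 * k) θ
    rw [show ((2 * k : ℕ) : ℝ) * (Real.pi / k) = 2 * Real.pi by push_cast; field_simp] at this
    rw [this]; push_cast; ring
  set q := 2 * b - 2 with hq
  have hq0 : 0 < q := by linarith
  set g : ℝ → ℝ := fun θ => Real.sin (φ θ) with hg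
  -- With `g = sin φ`, the curve `f² = 1 + a² - g² - a² |g|^(2b)` factors as `cos² φ · S(φ)²`,
  -- giving a signed root that changes sign at the turning points; `φ' = κ S(φ)` is then exactly `g'
  -- = κ f`.
  set f : ℝ → ℝ := fun θ => Real.cos (φ θ) * S (φ θ) with hf
  have hsq : ∀ s : ℝ, (s ^ 2) ^ b = |s| ^ (q + 2) := fun s => by
    rw [← sq_abs, ← Real.rpow_natCast, ← Real.rpow_mul (abs_nonneg s)]
    congr 1
    rw [hq]; push_cast; ring
  have hf2 : ∀ θ, f θ ^ 2 = 1 + a ^ 2 - g θ ^ 2 - a ^ 2 * |g θ| ^ (q + 2) := fun θ => by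
    rw [← hsq]
    simp only [hf, hg, mul_pow, hS]
    rw [phaseSpeed_sq hb1.le]
    linear_combination a ^ 2 * cos_sq_mul_powerQuotient b (φ θ) +
      Real.sin_sq_add_cos_sq (φ θ)
  have hgd : ∀ θ, HasDerivAt g (κ * f θ) θ := fun θ =>
    ((Real.hasDerivAt_sin (φ θ)).comp θ (hφd θ)).congr_deriv (by simp only [hf]; ring)
  have hfc : Continuous f := (Real.continuous_cos.comp hφc).mul (hSc.comp hφc)
  -- Differentiating the curve and cancelling `2f` gives `f' = N(g)`. As `q > 0`, `N` is `C¹`, which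
  -- lifts `f` and `g` to `C²`.
  set N : ℝ → ℝ := fun y => -κ * (y + a ^ 2 * b * (|y| ^ q * y)) with hN
  have hfd : ∀ θ, HasDerivAt f (N (g θ)) θ := by
    intro θ
    by_cases h0 : Real.cos (φ θ) = 0
    · have h1 := hasDerivAt_mul_of_eq_zero ((Real.hasDerivAt_cos (φ θ)).comp θ (hφd θ)) h0
        (hSc.comp hφc).continuousAt
      refine h1.congr_deriv ?_
      have h2 : |g θ| = 1 := by
        have : g θ ^ 2 = 1 := by simp only [hg]; rw [Real.sin_sq, h0]; simp
        rwa [← sq_abs, pow_eq_one_iff_of_nonneg (abs_nonneg _) two_ne_zero] at this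
      have h3 : S (φ θ) ^ 2 = 1 + a ^ 2 * b := by
        rw [hS, phaseSpeed_sq hb1.le, powerQuotient_of_cos_eq_zero b h0]
      simp only [hN, h2, Real.one_rpow, Function.comp]
      simp only [hg]
      linear_combination -Real.sin (φ θ) * κ * h3
    · have hf0 : f θ ≠ 0 := mul_ne_zero h0 (hSpos _).ne'
      refine hasDerivAt_of_hasDerivAt_sq hfc.continuousAt hf0 ?_
      have h1 := ((((hgd θ).fun_pow 2).const_sub (1 + a ^ 2)).fun_sub
        (((hasDerivAt_abs_rpow (g θ) (p := q + 2) (by linarith)).comp θ (hgd θ)).const_mul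
          (a ^ 2)))
      refine (h1.congr_of_eventuallyEq (Eventually.of_forall hf2)).congr_deriv ?_
      have h2 : q + 2 = 2 * b := by rw [hq]; ring
      simp only [hN, h2]
      norm_num
      ring
  have hNC : ContDiff ℝ 1 N := by
    have h1 : ContDiff ℝ 1 fun y : ℝ => |y| ^ q * y := by
      rw [contDiff_one_iff_deriv]
      refine ⟨fun y => (hasDerivAt_abs_rpow_mul_self hq0 y).differentiableAt, ?_⟩
      rw [show deriv (fun y : ℝ => |y| ^ q * y) = fun y => (q + 1) * |y| ^ q from
        funext fun y => (hasDerivAt_abs_rpow_mul_self hq0 y).deriv]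
      exact continuous_const.mul (continuous_abs.rpow_const fun _ => Or.inr hq0.le)
    exact contDiff_const.mul (contDiff_id.add (contDiff_const.mul h1))
  have hdg : deriv g = fun θ => κ * f θ := funext fun θ => (hgd θ).deriv
  have hdf : deriv f = fun θ => N (g θ) := funext fun θ => (hfd θ).deriv
  have hg1 : ContDiff ℝ 1 g := contDiff_one_iff_deriv.2
    ⟨fun θ => (hgd θ).differentiableAt, hdg ▸ continuous_const.mul hfc⟩
  have hfC : ContDiff ℝ 2 f := (contDiff_succ_iff_deriv (n := 1)).2
    ⟨fun θ => (hfd θ).differentiableAt, by simp, hdf ▸ hNC.comp hg1⟩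
  have hf1 : ContDiff ℝ 1 f := hfC.of_le one_le_two
  have hgC : ContDiff ℝ 2 g := (contDiff_succ_iff_deriv (n := 1)).2
    ⟨fun θ => (hgd θ).differentiableAt, by simp, hdg ▸ contDiff_const.mul hf1⟩
  -- This `c` cancels the constant `α (1 + a²)` that `α f²` contributes to the momentum equation.
  refine ⟨-(1 + a ^ 2) / 2, f, g, ⟨hf1, hg1, fun θ => (hgd θ).deriv, fun θ => ?_⟩, hfC, hgC,
    fun θ => ?_, fun θ => ?_, fun θ => ?_, fun θ => ?_, ?_⟩
  · have h1 : |g θ| ^ (q + 2) = |g θ| ^ q * g θ ^ 2 := by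
      by_cases h0 : g θ = 0
      · rw [h0, abs_zero, Real.zero_rpow (by linarith)]; simp
      · exact abs_rpow_two_add h0
    rw [hdf, hf2, h1]
    simp only [hN]
    linear_combination (-(a ^ 2 * (|g θ| ^ q * g θ ^ 2))) * hbκ - g θ ^ 2 * hκ
  · have hS2 : S (φ θ + k * (2 * Real.pi)) = S (φ θ) := by
      rw [show (k : ℝ) * (2 * Real.pi) = (2 * k : ℕ) * Real.pi by push_cast; ring]
      exact hSper.nat_mul (2 * k) (φ θ)
    simp only [hf, hφ2, hS2, Real.cos_add_nat_mul_two_pi]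
  · simp only [hg, hφ2, Real.sin_add_nat_mul_two_pi]
  · simp only [hf, hφneg, hSneg, Real.cos_neg]
  · simp only [hg, hφneg, Real.sin_neg]
  -- Where `g = 1` the angular vorticity equals `κ a² b`, nonzero because `a ≠ 0`.
  · obtain ⟨θ, hθ⟩ := hφsurj (Real.pi / 2)
    have hg1 : g θ = 1 := by simp only [hg, hθ, Real.sin_pi_div_two]
    refine ⟨θ, ?_⟩
    rw [ProfileSystem.angularVorticity, hdf]
    simp only [hN, hg1, abs_one, Real.one_rpow, mul_one]
    rw [show (1 - α) - -κ * (1 + a ^ 2 * b) = κ * (a ^ 2 * b) by rw [hκ]; ring]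
    positivity

end

theorem theorem1p7 :
    -- (i) nonexistence for `0 ≤ α ≤ 1` in the class `C¹`
    (∀ α : ℝ, 0 ≤ α → α ≤ 1 →
      ¬ ∃ (u : Plane → Plane) (p : Plane → ℝ),
        IsReflSymmHomogeneousEulerSolution {0}ᶜ α u p ∧
        ContDiffOn ℝ 1 u {0}ᶜ ∧ IsRotational u) ∧
    -- (ii) nonexistence for `-1 ≤ α < 0` in the class `C²`
    (∀ α : ℝ, -1 ≤ α → α < 0 →
      ¬ ∃ (u : Plane → Plane) (p : Plane → ℝ),
        IsReflSymmHomogeneousEulerSolution {0}ᶜ α u p ∧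
        ContDiffOn ℝ 2 u {0}ᶜ ∧ IsRotational u) ∧
    -- (iii) existence for `α > 1`
    (∀ α : ℝ, 1 < α →
      ∃ (u : Plane → Plane) (p : Plane → ℝ),
        IsReflSymmHomogeneousEulerSolution {0}ᶜ α u p ∧
        ContDiffOn ℝ 2 u {0}ᶜ ∧ IsRotational u) ∧
    -- (iv) existence for `α < -1`, on the whole plane
    (∀ α : ℝ, α < -1 →
      ∃ (u : Plane → Plane) (p : Plane → ℝ),
        IsReflSymmHomogeneousEulerSolution Set.univ α u p ∧
        ContDiffOn ℝ 1 u {0}ᶜ ∧ Continuous u ∧ IsRotational u) := by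
  refine ⟨?_, ?_, ?_, ?_⟩
  · rintro α h0 h1 ⟨u, p, h, hu, hrot⟩
    exact h.not_isRotational_of_le_one hu (by linarith) h1 hrot
  · rintro α h0 h1 ⟨u, p, h, hu, hrot⟩
    rcases h0.eq_or_lt with rfl | hlt
    · exact h.not_isRotational_of_eq_neg_one hu hrot
    · exact h.not_isRotational_of_le_one (hu.of_le one_le_two) hlt (by linarith) hrot
  · intro α hα
    obtain ⟨c, f, g, hs, hf, hg, hfp, hgp, hfe, hgo, hW⟩ := exists_rotational_profile hα
    exact hs.exists_isReflSymmHomogeneousEulerSolution (n := 2) one_le_two hf hg hfp hgp hfe hgo hW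
  · intro α hα
    have hs : 1 < -α := by linarith
    refine ⟨shearFlow (-α), 0, ?_, (contDiff_shearFlow hs).contDiffOn,
      (contDiff_shearFlow hs).continuous, shearFlow_isRotational hs⟩
    simpa using shearFlow_isReflSymmHomogeneousEulerSolution hs
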